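/- For real numbers $p\in[0,1]$ and $\alpha\ge 0$, a finite simple graph $G$ is called $(p,\alpha)$-jumbled if $$\bigl|e(X,Y)-p|X||Y|\bigr|\le \alpha\sqrt{|X||Y|}\qquad\text{for all } X,Y\subseteq V(G),$$ where $e(X,Y)$ is the number of edges with one end in $X$ and the other in $Y$, edges with both ends in $X\cap Y$ being counted twice. For a graph $F$, an integer $n\ge 1$ and a real number $C>0$, let $\mathrm{ex}_{\mathrm{rand}}(n,C,F)$ be the maximum number of edges of an $n$-vertex graph that does not contain $F$ as a (not necessarily induced) subgraph and that is $(p,\alpha)$-jumbled for some $p\in[0,1]$ and some $\alpha\ge 0$ with $\alpha\le C\sqrt{np}$. Let $$\exp(F)=\lim_{C\to\infty}\ \limsup_{n\to\infty}\ \frac{\log\bigl(\mathrm{ex}_{\mathrm{rand}}(n,C,F)/n\bigr)}{\log n},$$ with the convention $\log 0=-\infty$ (the limit exists in the extended reals, since the limsup is non-decreasing in $C$). **Theorem.** For every integer $t\ge 4$, $$\exp(K_t)\ \ge\ 1-\frac{1}{t-1}.$$ -/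

import Mathlib

open Filter Topology
open scoped ENNReal

namespace PseudorandomTuran

/-- `e(X, Y)`: the number of edges with one end in `X` and the other in `Y`, an edge with both
ends in `X ∩ Y` being counted twice (that is, the number of ordered adjacent pairs in `X × Y`). -/
noncomputable def edgesBetween {V : Type*} (G : SimpleGraph V) (X Y : Finset V) : ℕ := by
  classical exact (G.interedges X Y).card

/-- `(p, α)`-jumbled graphs, `p ∈ [0, 1]` and `α ≥ 0`. -/
def IsJumbled {V : Type*} (G : SimpleGraph V) (p α : ℝ) : Prop :=
  0 ≤ p ∧ p ≤ 1 ∧ 0 ≤ α ∧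
    ∀ X Y : Finset V,
      |(edgesBetween G X Y : ℝ) - p * (X.card : ℝ) * (Y.card : ℝ)| ≤
        α * Real.sqrt ((X.card : ℝ) * (Y.card : ℝ))

/-- The possible numbers of edges of an `n`-vertex `F`-free graph that is `(p, α)`-jumbled for
some `p` and `α` with `α ≤ C √(n p)`. There is no further restriction on `p`. -/
def jumbledFreeSizes {W : Type*} (n : ℕ) (C : ℝ) (F : SimpleGraph W) : Set ℕ :=
  {m | ∃ G : SimpleGraph (Fin n), F.Free G ∧
      (∃ p α : ℝ, IsJumbled G p α ∧ α ≤ C * Real.sqrt ((n : ℝ) * p)) ∧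
      m = G.edgeSet.ncard}

/-- `ex_rand(n, C, F)`: the largest number of edges of an `n`-vertex `F`-free graph that is
`(p, α)`-jumbled for some `p` and `α` with `α ≤ C √(n p)`. -/
noncomputable def exRand {W : Type*} (n : ℕ) (C : ℝ) (F : SimpleGraph W) : ℕ :=
  sSup (jumbledFreeSizes n C F)

/-- `limsup_{n → ∞} log (ex_rand(n, C, F) / n) / log n`, with `log 0 = -∞`. -/
noncomputable def exponentAt {W : Type*} (F : SimpleGraph W) (C : ℝ) : EReal :=
  limsup (fun n : ℕ =>
    ENNReal.log ((exRand n C F : ℝ≥0∞) / (n : ℝ≥0∞)) / ((Real.log (n : ℝ) : ℝ) : EReal)) atTop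

/-- `exp(F) = lim_{C → ∞} limsup_{n → ∞} log (ex_rand(n, C, F) / n) / log n`.
The limit exists, see `tendsto_exponentAt`. -/
noncomputable def randExponent {W : Type*} (F : SimpleGraph W) : EReal :=
  limUnder atTop (fun C : ℝ => exponentAt F C)

theorem bddAbove_jumbledFreeSizes {W : Type*} (n : ℕ) (C : ℝ) (F : SimpleGraph W) :
    BddAbove (jumbledFreeSizes n C F) := by
  refine ⟨(Set.univ : Set (Sym2 (Fin n))).ncard, ?_⟩
  rintro m ⟨G, -, -, rfl⟩
  exact Set.ncard_le_ncard (Set.subset_univ _) (Set.toFinite _)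

/-- `exRand` is a maximum whenever there is a graph to consider. -/
theorem isGreatest_exRand {W : Type*} (n : ℕ) (C : ℝ) (F : SimpleGraph W)
    (h : (jumbledFreeSizes n C F).Nonempty) :
    IsGreatest (jumbledFreeSizes n C F) (exRand n C F) :=
  ⟨Nat.sSup_mem h (bddAbove_jumbledFreeSizes n C F),
    fun _ hm => le_csSup (bddAbove_jumbledFreeSizes n C F) hm⟩

theorem exRand_mono {W : Type*} (n : ℕ) (F : SimpleGraph W) :
    Monotone (fun C : ℝ => exRand n C F) := by
  intro C D hCD
  have hsub : jumbledFreeSizes n C F ⊆ jumbledFreeSizes n D F := by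
    rintro m ⟨G, hG, ⟨p, α, hj, hα⟩, rfl⟩
    exact ⟨G, hG, ⟨p, α, hj, hα.trans
      (mul_le_mul_of_nonneg_right hCD (Real.sqrt_nonneg _))⟩, rfl⟩
  rcases (jumbledFreeSizes n C F).eq_empty_or_nonempty with h | h
  · simp [exRand, h]
  · exact csSup_le_csSup (bddAbove_jumbledFreeSizes n D F) h hsub

theorem exponentAt_mono {W : Type*} (F : SimpleGraph W) : Monotone (exponentAt F) := by
  intro C D hCD
  refine limsup_le_limsup (Eventually.of_forall fun n => ?_)
  refine EReal.div_le_div_right_of_nonneg ?_ ?_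
  · exact_mod_cast Real.log_natCast_nonneg n
  · refine ENNReal.log_monotone (ENNReal.div_le_div_right ?_ _)
    exact_mod_cast exRand_mono n F hCD

/-- The limit that defines `exp(F)` exists. -/
theorem tendsto_exponentAt {W : Type*} (F : SimpleGraph W) :
    Tendsto (fun C : ℝ => exponentAt F C) atTop (𝓝 (randExponent F)) :=
  tendsto_nhds_limUnder ⟨_, tendsto_atTop_iSup (exponentAt_mono F)⟩

end PseudorandomTuran

/-! Let `A` be a symmetric form of nonsquare determinant on `F^t`, `q = |F|` odd. Join vectors of
`A`-norm 1 when they are `A`-orthogonal. A copy of `K_t` would be the rows of some `M` with `M A Mᵀ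
= 1`, making `det A` a square.

Jumbledness comes from a second moment over all `z` in `F^t`. The conditions "`z` orthogonal to `A
y`" are independent for non-parallel vectors, and a unit vector is parallel only to itself and its
negative, so the number of `y ∈ Y` orthogonal to `z` has variance `O(|Y| / q)`. This number depends
only on the line of `z`, and each line contains at most two unit vectors. Restricting to unit
vectors therefore saves a further factor `q`, and Cauchy–Schwarz gives `α = O(q^((t-2)/2))`.

With `p = 1/q` and at least `q^(t-1) / 2` unit vectors, `α ≤ 4 √(n p)`, and there are at least `n^2
/ (4q)` edges, of order at least `n^(2 - 1/(t-1))`. Letting `q` run over primes suffices for a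
limsup. -/

namespace PseudorandomTuran
open Matrix Finset

/-! ### Second moment of orthogonality counts -/

section SecondMoment

variable {ι F V : Type*} [Fintype ι] [DecidableEq ι] [Field F] [Fintype F] [DecidableEq F]

omit [DecidableEq F] in
theorem card_fiber_mul_of_surjective {W : Type*} [AddCommGroup W] [Fintype W] [DecidableEq W]
    [Module F W] (f : (ι → F) →ₗ[F] W) (hf : Function.Surjective f) :
    #{z : ι → F | f z = 0} * Fintype.card W = Fintype.card (ι → F) := by
  have h1 := Submodule.card_eq_card_quotient_mul_card (LinearMap.ker f)
  have h2 : Nat.card (LinearMap.ker f) = #{z : ι → F | f z = 0} := by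
    rw [← Fintype.card_subtype, ← Nat.card_eq_fintype_card]
    exact Nat.card_congr (Equiv.refl _)
  rwa [Nat.card_congr (LinearMap.quotKerEquivOfSurjective f hf).toEquiv, h2,
    Nat.card_eq_fintype_card, Nat.card_eq_fintype_card, eq_comm] at h1

theorem card_orthogonal_mul (w : ι → F) (hw : w ≠ 0) :
    #{z : ι → F | z ⬝ᵥ w = 0} * Fintype.card F = Fintype.card (ι → F) := by
  obtain ⟨i, hi⟩ := Function.ne_iff.1 hw
  refine card_fiber_mul_of_surjective (W := F)
    { toFun := fun z => z ⬝ᵥ w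
      map_add' := fun a b => add_dotProduct a b w
      map_smul' := fun c a => smul_dotProduct c a w } fun c => ⟨Pi.single i (c / w i), ?_⟩
  simp only [LinearMap.coe_mk, AddHom.coe_mk, single_dotProduct]
  exact div_mul_cancel₀ c hi

theorem card_orthogonal_pair_mul (w w' : ι → F) (hw : w ≠ 0) (h : ∀ c : F, w' ≠ c • w) :
    #{z : ι → F | z ⬝ᵥ w = 0 ∧ z ⬝ᵥ w' = 0} * Fintype.card F ^ 2 = Fintype.card (ι → F) := by
  obtain ⟨i, hi⟩ := Function.ne_iff.1 hw
  obtain ⟨j, hj⟩ := Function.ne_iff.1 (h (w' i / w i))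
  have hi' : w i ≠ 0 := hi
  have hD : w' j * w i - w j * w' i ≠ 0 := by
    intro h0
    apply hj
    simp only [Pi.smul_apply, smul_eq_mul]
    field_simp
    linear_combination h0
  have := card_fiber_mul_of_surjective (W := F × F)
    { toFun := fun z : ι → F => (z ⬝ᵥ w, z ⬝ᵥ w')
      map_add' := fun a b => by simp [add_dotProduct]
      map_smul' := fun c a => by simp [smul_dotProduct] } fun c => by
      -- Cramer's rule on coordinates `i`, `j`, whose `2 × 2` minor is nonzero by `hD`.
      set b := (c.2 - c.1 * w' i / w i) / (w' j * w i - w j * w' i) with hb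
      have hb' : b * (w' j * w i - w j * w' i) = c.2 - c.1 * w' i / w i := div_mul_cancel₀ _ hD
      refine ⟨Pi.single i (c.1 / w i - w j * b) + Pi.single j (w i * b), ?_⟩
      simp only [LinearMap.coe_mk, AddHom.coe_mk, add_dotProduct, single_dotProduct]
      ext
      · simp only; field_simp; ring
      · simp only; linear_combination hb'
  simpa [sq, Prod.ext_iff] using this

/-- The number of `y ∈ Y` for which `w y` is orthogonal to `z`. -/
def orthogonalCount (w : V → ι → F) (Y : Finset V) (z : ι → F) : ℕ := #{y ∈ Y | z ⬝ᵥ w y = 0}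

omit [DecidableEq ι] [Fintype F] in
theorem orthogonalCount_smul (w : V → ι → F) (Y : Finset V) (z : ι → F) (s : Fˣ) :
    orthogonalCount w Y (s • z) = orthogonalCount w Y z := by
  simp [orthogonalCount, Units.smul_def, smul_dotProduct]

theorem sum_orthogonalCount (w : V → ι → F) (hw : ∀ y, w y ≠ 0) (Y : Finset V) :
    (∑ z, orthogonalCount w Y z) * Fintype.card F = #Y * Fintype.card (ι → F) := by
  simp only [orthogonalCount, card_filter]
  rw [sum_comm, sum_mul]
  simp_rw [← card_filter, card_orthogonal_mul _ (hw _)]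
  simp

/-- Expand the square over pairs in `Y`. A non-parallel pair is orthogonal to a `q⁻²` fraction of
all `z`, a parallel pair to at most a `q⁻¹` fraction, and each `y` has at most two parallel
partners, itself included. -/
theorem sum_sq_orthogonalCount_le (w : V → ι → F) (hw : ∀ y, w y ≠ 0) (Y : Finset V)
    (h : ∀ y ∈ Y, #{y' ∈ Y | ∃ c : F, w y' = c • w y} ≤ 2) :
    (∑ z, orthogonalCount w Y z ^ 2) * Fintype.card F ^ 2 ≤
      (#Y ^ 2 + 2 * #Y * Fintype.card F) * Fintype.card (ι → F) := by
  classical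
  have e : ∀ z, orthogonalCount w Y z ^ 2
      = ∑ y ∈ Y, ∑ y' ∈ Y, if z ⬝ᵥ w y = 0 ∧ z ⬝ᵥ w y' = 0 then 1 else 0 := by
    intro z
    simp only [orthogonalCount, card_filter, sq, sum_mul_sum]
    refine sum_congr rfl fun y _ => sum_congr rfl fun y' _ => ?_
    by_cases h1 : z ⬝ᵥ w y = 0 <;> by_cases h2 : z ⬝ᵥ w y' = 0 <;> simp [h1, h2]
  simp_rw [e]
  rw [sum_comm, sum_mul]
  have key : ∀ y ∈ Y, (∑ z, ∑ y' ∈ Y, if z ⬝ᵥ w y = 0 ∧ z ⬝ᵥ w y' = 0 then 1 else 0) *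
      Fintype.card F ^ 2 ≤ (#Y + 2 * Fintype.card F) * Fintype.card (ι → F) := by
    intro y hy
    rw [sum_comm, sum_mul]
    calc _ ≤ ∑ y' ∈ Y, (Fintype.card (ι → F) + if ∃ c : F, w y' = c • w y then
            Fintype.card F * Fintype.card (ι → F) else 0) := by
          refine sum_le_sum fun y' _ => ?_
          rw [← card_filter]
          split_ifs with hc
          · have h1 := card_orthogonal_mul (w y) (hw y)
            have h2 : #{z : ι → F | z ⬝ᵥ w y = 0 ∧ z ⬝ᵥ w y' = 0} ≤ #{z : ι → F | z ⬝ᵥ w y = 0} :=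
              card_le_card (monotone_filter_right _ fun _ _ h => h.1)
            calc _ ≤ #{z : ι → F | z ⬝ᵥ w y = 0} * Fintype.card F ^ 2 := by gcongr
              _ = Fintype.card F * Fintype.card (ι → F) := by rw [← h1]; ring
              _ ≤ _ := Nat.le_add_left _ _
          · push Not at hc
            rw [card_orthogonal_pair_mul _ _ (hw y) hc, add_zero]
      _ = #Y * Fintype.card (ι → F) + #{y' ∈ Y | ∃ c : F, w y' = c • w y} *
            (Fintype.card F * Fintype.card (ι → F)) := by
          rw [sum_add_distrib, sum_const, ← sum_filter, sum_const, smul_eq_mul, smul_eq_mul]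
      _ ≤ #Y * Fintype.card (ι → F) + 2 * (Fintype.card F * Fintype.card (ι → F)) := by
          gcongr; exact h y hy
      _ = _ := by ring
  refine (sum_le_sum key).trans (le_of_eq ?_)
  rw [sum_const, smul_eq_mul]
  ring

theorem sum_sq_orthogonalCount_sub_le (w : V → ι → F) (hw : ∀ y, w y ≠ 0) (Y : Finset V)
    (h : ∀ y ∈ Y, #{y' ∈ Y | ∃ c : F, w y' = c • w y} ≤ 2) :
    ∑ z, ((orthogonalCount w Y z : ℝ) - #Y / Fintype.card F) ^ 2 ≤
      2 * #Y * Fintype.card (ι → F) / Fintype.card F := by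
  have hq : (0 : ℝ) < Fintype.card F := by exact_mod_cast Fintype.card_pos
  have h1 : (∑ z, (orthogonalCount w Y z : ℝ)) * Fintype.card F = #Y * Fintype.card (ι → F) := by
    exact_mod_cast sum_orthogonalCount w hw Y
  have h2 : (∑ z, (orthogonalCount w Y z : ℝ) ^ 2) * Fintype.card F ^ 2 ≤
      (#Y ^ 2 + 2 * #Y * Fintype.card F) * Fintype.card (ι → F) := by
    exact_mod_cast sum_sq_orthogonalCount_le w hw Y h
  have e : ∑ z, ((orthogonalCount w Y z : ℝ) - #Y / Fintype.card F) ^ 2 =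
      (∑ z, (orthogonalCount w Y z : ℝ) ^ 2) - 2 * (#Y / Fintype.card F) *
        (∑ z, (orthogonalCount w Y z : ℝ)) + Fintype.card (ι → F) * (#Y / Fintype.card F) ^ 2 := by
    simp_rw [sub_sq]
    rw [sum_add_distrib, sum_sub_distrib, sum_const, card_univ, nsmul_eq_mul, mul_sum]
    congr 2
    exact sum_congr rfl fun _ _ => by ring
  rw [← eq_div_iff hq.ne'] at h1
  rw [← le_div_iff₀ (by positivity)] at h2
  rw [e, h1]
  refine (add_le_add_left (sub_le_sub_right h2 _) _).trans (le_of_eq ?_)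
  field_simp
  ring

end SecondMoment

/-! ### Orthogonality graphs of unit vectors -/

section OrthogonalityGraph

variable {ι F V : Type*} [Fintype ι] [DecidableEq ι] [Field F]

/-- The graph on a family of unit vectors for the symmetric form `A`, adjacency being
orthogonality. -/
def orthogonalityGraph (A : Matrix ι ι F) (hA : A.IsSymm) (v : V → ι → F)
    (hv : ∀ i, v i ⬝ᵥ A *ᵥ v i = 1) : SimpleGraph V where
  Adj i j := v i ⬝ᵥ A *ᵥ v j = 0
  symm := ⟨fun i j h => by
    rw [dotProduct_mulVec, dotProduct_comm, ← mulVec_transpose, hA.eq] at h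
    exact h⟩
  loopless := ⟨fun i h => by rw [hv i] at h; exact one_ne_zero h⟩

variable (A : Matrix ι ι F) (hA : A.IsSymm) (v : V → ι → F) (hv : ∀ i, v i ⬝ᵥ A *ᵥ v i = 1)

theorem orthogonalityGraph_cliqueFree (hdet : ¬ IsSquare A.det) {n : ℕ}
    (hn : Fintype.card ι = n) :
    (SimpleGraph.completeGraph (Fin n)).Free (orthogonalityGraph A hA v hv) := by
  rintro ⟨f⟩
  let e : ι ≃ Fin n := Fintype.equivFinOfCardEq hn
  let M : Matrix ι ι F := Matrix.of fun i => v (f (e i))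
  have hM : M * A * Mᵀ = 1 := by
    ext i j
    have : (M * A * Mᵀ) i j = v (f (e i)) ⬝ᵥ A *ᵥ v (f (e j)) := by
      rw [Matrix.mul_assoc, Matrix.mul_apply_eq_vecMul, vecMul, dotProduct, dotProduct]
      refine sum_congr rfl fun k _ => ?_
      rfl
    rw [this, one_apply]
    split_ifs with hij
    · rw [hij, hv]
    · exact f.toHom.map_adj (show (⊤ : SimpleGraph (Fin n)).Adj (e i) (e j) from
        fun h => hij (e.injective h))
  have hd := congrArg det hM
  rw [det_mul, det_mul, det_transpose, det_one] at hd
  have h0 : M.det ≠ 0 := by rintro h0; simp [h0] at hd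
  exact hdet ⟨M.det⁻¹, by field_simp; linear_combination hd⟩

variable [Fintype F] [DecidableEq F]

omit [DecidableEq ι] [Fintype F] [DecidableEq F] in
include hv in
theorem eq_or_eq_neg_of_smul_eq {x y : V} {s r : F} (h : s • v x = r • v y) : s = r ∨ s = -r := by
  have : s * s * (v x ⬝ᵥ A *ᵥ v x) = r * r * (v y ⬝ᵥ A *ᵥ v y) := by
    have := congrArg (fun u => u ⬝ᵥ A *ᵥ u) h
    simpa [smul_dotProduct, dotProduct_smul, mulVec_smul, mul_assoc] using this
  rw [hv, hv, mul_one, mul_one] at this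
  exact mul_self_eq_mul_self_iff.1 this

omit [DecidableEq ι] [Fintype F] [DecidableEq F] in
include hv in
theorem mulVec_ne_zero_of_unit (y : V) : A *ᵥ v y ≠ 0 := fun h => by
  have := hv y
  rw [h, dotProduct_zero] at this
  exact zero_ne_one this

include hv in
theorem card_parallel_le_two (hdet : A.det ≠ 0) (hinj : Function.Injective v) (Y : Finset V)
    (y : V) : #{y' ∈ Y | ∃ c : F, A *ᵥ v y' = c • A *ᵥ v y} ≤ 2 := by
  refine (card_le_card_of_injOn (t := {v y, -v y}) v ?_ hinj.injOn).trans card_le_two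
  intro y' hy'
  obtain ⟨c, hc⟩ := (mem_filter.1 hy').2
  rw [← mulVec_smul] at hc
  have hc' : v y' = c • v y :=
    mulVec_injective_of_isUnit ((isUnit_iff_isUnit_det A).2 hdet.isUnit) hc
  rcases eq_or_eq_neg_of_smul_eq A v hv (x := y') (y := y) (s := 1) (r := c) (by rw [one_smul, hc']) with h | h
  · rw [hc', ← h]; simp
  · rw [hc', show c = -1 by rw [h, neg_neg]]; simp

include hv in
-- Equal multiples `s • v x = r • v y` of unit vectors force `s = ± r`, and the scalar then
-- determines the vertex, so each `z` is hit at most twice.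
theorem sum_units_smul_le [DecidableEq V] (hinj : Function.Injective v) (X : Finset V)
    (D : (ι → F) → ℝ) (hD : ∀ z, 0 ≤ D z) :
    ∑ p ∈ (univ : Finset Fˣ) ×ˢ X, D (p.1 • v p.2) ≤ 2 * ∑ z, D z := by
  rw [← sum_fiberwise_of_maps_to (t := univ) (g := fun p : Fˣ × V => p.1 • v p.2)
    (fun _ _ => mem_univ _), mul_sum]
  refine sum_le_sum fun z _ => ?_
  rw [sum_congr rfl (g := fun _ => D z) fun p hp => by rw [(mem_filter.1 hp).2], sum_const,
    nsmul_eq_mul]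
  refine mul_le_mul_of_nonneg_right ?_ (hD z)
  norm_cast
  rcases Finset.eq_empty_or_nonempty {p ∈ (univ : Finset Fˣ) ×ˢ X | p.1 • v p.2 = z} with h | ⟨p₀, h₀⟩
  · simp [h]
  have h₀' := (mem_filter.1 h₀).2
  refine (card_le_card_of_injOn (t := {p₀.1, -p₀.1}) Prod.fst ?_ ?_).trans card_le_two
  · intro p hp
    have hp' := (mem_filter.1 hp).2
    rcases eq_or_eq_neg_of_smul_eq A v hv (hp'.trans h₀'.symm) with h | h
    · have : p.1 = p₀.1 := Units.ext h
      simp [this]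
    · have : p.1 = -p₀.1 := Units.ext h
      simp [this]
  · intro p hp r hr hpr
    have hp' := (mem_filter.1 hp).2
    have hr' := (mem_filter.1 hr).2
    refine Prod.ext hpr (hinj ?_)
    have : p.1 • v p.2 = p.1 • v r.2 := by rw [hp', ← hr', hpr]
    exact smul_left_cancel _ this

include hv in
theorem sum_sq_orthogonalCount_unit_le (hdet : A.det ≠ 0) (hinj : Function.Injective v)
    (X Y : Finset V) :
    ((Fintype.card F : ℝ) - 1) *
      ∑ x ∈ X, ((orthogonalCount (fun y => A *ᵥ v y) Y (v x) : ℝ) - #Y / Fintype.card F) ^ 2 ≤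
      4 * #Y * Fintype.card (ι → F) / Fintype.card F := by
  classical
  have h1 := sum_sq_orthogonalCount_sub_le (fun y => A *ᵥ v y) (mulVec_ne_zero_of_unit A v hv) Y
    fun y _ => card_parallel_le_two A v hv hdet hinj Y y
  have h2 := sum_units_smul_le A v hv hinj X
    (fun z => ((orthogonalCount (fun y => A *ᵥ v y) Y z : ℝ) - #Y / Fintype.card F) ^ 2)
    fun _ => sq_nonneg _
  rw [sum_product] at h2
  simp only [orthogonalCount_smul, sum_const, card_univ, nsmul_eq_mul] at h2
  rw [Fintype.card_units, Nat.cast_sub Fintype.card_pos, Nat.cast_one] at h2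
  refine h2.trans ((mul_le_mul_of_nonneg_left h1 zero_le_two).trans (le_of_eq ?_))
  ring

end OrthogonalityGraph
-- Jumbledness
section Jumbled

variable {ι F V : Type*} [Fintype ι] [DecidableEq ι] [Field F] [Fintype F] [DecidableEq F]
variable (A : Matrix ι ι F) (hA : A.IsSymm) (v : V → ι → F) (hv : ∀ i, v i ⬝ᵥ A *ᵥ v i = 1)

omit [DecidableEq ι] [Fintype F] in
theorem edgesBetween_orthogonalityGraph (X Y : Finset V) :
    edgesBetween (orthogonalityGraph A hA v hv) X Y =
      ∑ x ∈ X, orthogonalCount (fun y => A *ᵥ v y) Y (v x) := by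
  classical
  simp only [edgesBetween, orthogonalCount, card_filter, SimpleGraph.interedges, Rel.interedges,
    sum_product]
  refine sum_congr rfl fun x _ => sum_congr rfl fun y _ => ?_
  exact if_congr Iff.rfl rfl rfl

theorem isJumbled_orthogonalityGraph (hdet : A.det ≠ 0) (hinj : Function.Injective v) :
    IsJumbled (orthogonalityGraph A hA v hv) (1 / Fintype.card F)
      (√(8 * Fintype.card (ι → F) / Fintype.card F ^ 2)) := by
  have hq : (2 : ℝ) ≤ Fintype.card F := by exact_mod_cast Fintype.one_lt_card (α := F)
  refine ⟨by positivity, by rw [div_le_one (by linarith)]; linarith, Real.sqrt_nonneg _,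
    fun X Y => ?_⟩
  have h1 := sum_sq_orthogonalCount_unit_le A v hv hdet hinj X Y
  set D := fun x => (orthogonalCount (fun y => A *ᵥ v y) Y (v x) : ℝ) - #Y / Fintype.card F with hD
  have h2 : ∑ x ∈ X, D x ^ 2 ≤ 8 * Fintype.card (ι → F) / Fintype.card F ^ 2 * #Y := by
    have h0 : 0 ≤ ∑ x ∈ X, D x ^ 2 := sum_nonneg fun _ _ => sq_nonneg _
    -- Replacing `q - 1` by `q / 2` turns the constant 4 into 8.
    have h3 : (Fintype.card F : ℝ) / 2 * ∑ x ∈ X, D x ^ 2 ≤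
        4 * #Y * Fintype.card (ι → F) / Fintype.card F :=
      (mul_le_mul_of_nonneg_right (by linarith) h0).trans h1
    rw [← le_div_iff₀' (by linarith)] at h3
    refine h3.trans (le_of_eq ?_)
    field_simp
    ring
  have e : (edgesBetween (orthogonalityGraph A hA v hv) X Y : ℝ) -
      1 / Fintype.card F * #X * #Y = ∑ x ∈ X, D x := by
    rw [edgesBetween_orthogonalityGraph, hD, sum_sub_distrib, sum_const, nsmul_eq_mul]
    push_cast
    ring
  rw [e, ← Real.sqrt_mul (by positivity)]
  refine Real.abs_le_sqrt ((sq_sum_le_card_mul_sum_sq (s := X) (f := D)).trans ?_)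
  calc (#X : ℝ) * ∑ x ∈ X, D x ^ 2
      ≤ #X * (8 * Fintype.card (ι → F) / Fintype.card F ^ 2 * #Y) := by gcongr
    _ = _ := by ring

end Jumbled

/-! ### Choice of the form and edge count -/

theorem edgesBetween_univ {n : ℕ} (G : SimpleGraph (Fin n)) :
    edgesBetween G univ univ = 2 * G.edgeSet.ncard := by
  classical
  rw [Set.ncard_eq_toFinset_card', show G.edgeSet.toFinset = G.edgeFinset from rfl,
    ← G.sum_degrees_eq_twice_card_edges, edgesBetween]
  simp only [SimpleGraph.interedges, Rel.interedges, card_filter, sum_product]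
  refine sum_congr rfl fun x _ => ?_
  rw [← card_filter, ← G.card_neighborFinset_eq_degree, G.neighborFinset_eq_filter]

/-- In a hyperbolic plane plus a diagonal form, a nonzero first coordinate and an arbitrary diagonal
part determine the second coordinate of a unit vector. -/
theorem exists_symm_nonsquare_det_card_le (F : Type*) [Field F] [Fintype F] [DecidableEq F]
    (hF : ringChar F ≠ 2) (m : ℕ) :
    ∃ A : Matrix (Fin 2 ⊕ Fin (m + 1)) (Fin 2 ⊕ Fin (m + 1)) F, A.IsSymm ∧ ¬ IsSquare A.det ∧
      (Fintype.card F - 1) * Fintype.card F ^ (m + 1) ≤ #{x | x ⬝ᵥ A *ᵥ x = 1} := by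
  obtain ⟨a, ha⟩ := FiniteField.exists_nonsquare hF
  have h2 : (2 : F) ≠ 0 := Ring.two_ne_zero hF
  -- The hyperbolic block has determinant `-1`, so the entry `-a` makes the total determinant `a`.
  let d : Fin (m + 1) → F := Fin.cons (-a) 1
  refine ⟨fromBlocks !![0, 1; 1, 0] 0 0 (diagonal d), ?_, ?_, ?_⟩
  · refine IsSymm.fromBlocks ?_ (by simp) (isSymm_diagonal d)
    ext i j
    fin_cases i <;> fin_cases j <;> rfl
  · rw [det_fromBlocks_zero₂₁, det_diagonal, det_fin_two_of, Fin.prod_univ_succ]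
    simpa [d] using ha
  · let r : (Fin (m + 1) → F) → F := fun y => y ⬝ᵥ diagonal d *ᵥ y
    have key := card_le_card_of_injOn (s := (univ : Finset (Fˣ × (Fin (m + 1) → F))))
      (t := {x | x ⬝ᵥ fromBlocks !![0, 1; 1, 0] 0 0 (diagonal d) *ᵥ x = 1})
      (fun p => Sum.elim ![(p.1 : F), (1 - r p.2) / (2 * p.1)] p.2) ?_ ?_
    · simpa [Fintype.card_units] using key
    · rintro ⟨u, y⟩ -
      have hu : (u : F) ≠ 0 := u.ne_zero
      simp only [coe_filter, mem_univ, true_and, Set.mem_ofPred_eq]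
      rw [fromBlocks_mulVec, sumElim_dotProduct_sumElim]
      have : ![(u : F), (1 - r y) / (2 * u)] ⬝ᵥ
          !![0, 1; 1, 0] *ᵥ ![(u : F), (1 - r y) / (2 * u)] = 1 - r y := by
        simp [dotProduct, mulVec, Fin.sum_univ_two]
        field_simp
        ring
      simp only [Sum.elim_comp_inl, Sum.elim_comp_inr, zero_mulVec, add_zero, zero_add]
      rw [this]
      exact sub_add_cancel 1 (r y)
    · rintro ⟨u, y⟩ - ⟨u', y'⟩ - h
      have h0 := congrFun h (Sum.inl 0)
      have h1 := fun i => congrFun h (Sum.inr i)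
      exact Prod.ext (Units.ext (by simpa using h0)) (funext fun i => by simpa using h1 i)

theorem exists_le_exRand (t : ℕ) (ht : 4 ≤ t) (F : Type*) [Field F] [Fintype F]
    (hF : ringChar F ≠ 2) (hq : 12 ≤ Fintype.card F) :
    ∃ n : ℕ, (Fintype.card F : ℝ) ^ (t - 1) ≤ 2 * n ∧
      (n : ℝ) ^ 2 / (4 * Fintype.card F) ≤
        exRand n 4 (SimpleGraph.completeGraph (Fin t)) := by
  classical
  obtain ⟨m, rfl⟩ : ∃ m, t = m + 1 + 2 := ⟨t - 3, by omega⟩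
  obtain ⟨A, hA, hsq, hcard⟩ := exists_symm_nonsquare_det_card_le F hF m
  obtain ⟨n, v, hinj, hv, hn⟩ : ∃ (n : ℕ) (v : Fin n → Fin 2 ⊕ Fin (m + 1) → F),
      Function.Injective v ∧ (∀ i, v i ⬝ᵥ A *ᵥ v i = 1) ∧
        (Fintype.card F - 1) * Fintype.card F ^ (m + 1) ≤ n :=
    ⟨_, fun i => (Finset.equivFin _).symm i,
      Subtype.val_injective.comp (Finset.equivFin _).symm.injective,
      fun i => (mem_filter.1 ((Finset.equivFin _).symm i).2).2, hcard⟩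
  have hdet : A.det ≠ 0 := fun h => hsq (h ▸ IsSquare.zero)
  have hJ := isJumbled_orthogonalityGraph A hA v hv hdet hinj
  have hfree := orthogonalityGraph_cliqueFree A hA v hv hsq (n := m + 1 + 2) (by
    simp [add_comm])
  have hcV : (Fintype.card (Fin 2 ⊕ Fin (m + 1) → F) : ℝ) = (Fintype.card F : ℝ) ^ (m + 1 + 2) := by
    simp [add_comm]
  have hcard' : ((Fintype.card F : ℝ) - 1) * (Fintype.card F : ℝ) ^ (m + 1) ≤ n := by
    rw [← Nat.cast_one, ← Nat.cast_sub Fintype.card_pos]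
    exact_mod_cast hn
  have hq' : (12 : ℝ) ≤ Fintype.card F := by exact_mod_cast hq
  rw [hcV] at hJ
  clear hn hcard hcV
  generalize (Fintype.card F : ℝ) = q at *
  have hn : q ^ (m + 2) ≤ 2 * n := by
    have : q / 2 * q ^ (m + 1) ≤ (q - 1) * q ^ (m + 1) := by gcongr; linarith
    rw [pow_succ]
    linarith
  -- Squared, this is exactly `hn`; hence the constant 4.
  have hα : √(8 * q ^ (m + 1 + 2) / q ^ 2) ≤ 4 * √(n * (1 / q)) := by
    rw [show (4 : ℝ) = √(4 ^ 2) by rw [Real.sqrt_sq (by norm_num)], ← Real.sqrt_mul (by norm_num)]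
    refine Real.sqrt_le_sqrt ?_
    rw [pow_add, mul_div_assoc, mul_div_cancel_right₀ _ (by positivity), ← mul_assoc,
      mul_one_div, le_div_iff₀ (by linarith), mul_assoc, ← pow_succ]
    linarith
  refine ⟨n, by simpa using hn, ?_⟩
  have hmem : (orthogonalityGraph A hA v hv).edgeSet.ncard ∈
      jumbledFreeSizes n 4 (SimpleGraph.completeGraph (Fin (m + 1 + 2))) :=
    ⟨_, hfree, ⟨_, _, hJ, hα⟩, rfl⟩
  have hle := (isGreatest_exRand n 4 _ ⟨_, hmem⟩).2 hmem
  refine le_trans ?_ (Nat.cast_le.2 hle)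
  have hb := (abs_le.1 (hJ.2.2.2 univ univ)).1
  rw [edgesBetween_univ, card_univ, Fintype.card_fin, Real.sqrt_mul_self (by positivity)] at hb
  push_cast at hb
  have hm : 1 ≤ m := by omega
  -- With `n / q ≥ 64`, the error `4 √(n/q) n` is at most half of the main term `n^2 / q`. Here `q ≥
  -- 12` and `t ≥ 4` give `n / q ≥ q^2 / 2 ≥ 72`.
  have hnq : 64 ≤ n * (1 / q) := by
    rw [mul_one_div, le_div_iff₀ (by linarith)]
    have : q ^ 3 ≤ q ^ (m + 2) := pow_le_pow_right₀ (by linarith) (by omega)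
    nlinarith [mul_le_mul hq' hq' (by norm_num) (by linarith)]
  have hsqrt : √(n * (1 / q)) * 8 ≤ n * (1 / q) := by
    have h1 : 8 ≤ √(n * (1 / q)) := Real.le_sqrt_of_sq_le (by linarith)
    have h2 := Real.mul_self_sqrt (show 0 ≤ n * (1 / q) by linarith)
    nlinarith
  have hfin : √(8 * q ^ (m + 1 + 2) / q ^ 2) * n ≤ n * (1 / q) / 2 * n := by
    gcongr; linarith
  have : (n : ℝ) ^ 2 / (4 * q) = n * (1 / q) * n / 4 := by field_simp
  rw [this]
  linarith

/-! ### Passage to exponents -/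

theorem le_log_exRand_div {n : ℕ} {t : ℕ} (ht : 4 ≤ t) {q : ℝ} (hq : 0 < q) (hn : 2 ≤ n)
    (hqn : q ^ (t - 1) ≤ 2 * n) {N : ℕ} (hN : (n : ℝ) ^ 2 / (4 * q) ≤ N) :
    (((1 - 1 / ((t : ℝ) - 1)) - Real.log 8 / Real.log n : ℝ) : EReal) ≤
      ENNReal.log ((N : ℝ≥0∞) / (n : ℝ≥0∞)) / ((Real.log (n : ℝ) : ℝ) : EReal) := by
  have hn' : (2 : ℝ) ≤ n := by exact_mod_cast hn
  have hlog : 0 < Real.log n := Real.log_pos (by linarith)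
  have ht' : (4 : ℝ) ≤ t := by exact_mod_cast ht
  have hN0 : (0 : ℝ) < N := lt_of_lt_of_le (by positivity) hN
  have h1 : (N : ℝ≥0∞) / (n : ℝ≥0∞) = ENNReal.ofReal (N / n) := by
    rw [ENNReal.ofReal_div_of_pos (by linarith), ENNReal.ofReal_natCast, ENNReal.ofReal_natCast]
  rw [h1, ENNReal.log_ofReal_of_pos (by positivity), ← EReal.coe_div, EReal.coe_le_coe_iff,
    le_div_iff₀ hlog, sub_mul, div_mul_cancel₀ _ hlog.ne']
  have h2 : Real.log q * (t - 1) ≤ Real.log 2 + Real.log n := by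
    have := Real.log_le_log (by positivity) hqn
    rw [Real.log_pow, Real.log_mul (by norm_num) (by linarith),
      Nat.cast_sub (by omega), Nat.cast_one] at this
    linarith
  have h3 : Real.log n - Real.log 4 - Real.log q ≤ Real.log (N / n) := by
    rw [← Real.log_div (by positivity) (by norm_num), ← Real.log_div (by positivity) hq.ne']
    refine Real.log_le_log (by positivity) ?_
    rw [le_div_iff₀ (by linarith)]
    refine le_trans (le_of_eq ?_) hN
    field_simp
  have h4 : Real.log q ≤ Real.log 2 + 1 / ((t : ℝ) - 1) * Real.log n := by
    rw [← le_div_iff₀ (by linarith), add_div] at h2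
    have : Real.log 2 / ((t : ℝ) - 1) ≤ Real.log 2 :=
      div_le_self (Real.log_nonneg (by norm_num)) (by linarith)
    rw [one_div_mul_eq_div]
    linarith
  have h5 : Real.log 8 = Real.log 4 + Real.log 2 := by
    rw [← Real.log_mul (by norm_num) (by norm_num)]; norm_num
  linarith

theorem frequently_le_exRand (t : ℕ) (ht : 4 ≤ t) :
    ∃ᶠ n : ℕ in atTop, (((1 - 1 / ((t : ℝ) - 1)) - Real.log 8 / Real.log n : ℝ) : EReal) ≤
      ENNReal.log ((exRand n 4 (SimpleGraph.completeGraph (Fin t)) : ℝ≥0∞) / (n : ℝ≥0∞)) /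
        ((Real.log (n : ℝ) : ℝ) : EReal) := by
  rw [frequently_atTop]
  intro N
  -- The bound makes `p` odd, at least 12, and large enough that `p ≤ 2 * n` yields `N ≤ n`.
  obtain ⟨p, hp, hprime⟩ := Nat.exists_infinite_primes (2 * N + 12)
  have : Fact p.Prime := ⟨hprime⟩
  obtain ⟨n, hn, hE⟩ := exists_le_exRand t ht (ZMod p)
    (by rw [ZMod.ringChar_zmod_n]; omega) (by rw [ZMod.card]; omega)
  rw [ZMod.card] at hn hE
  have hpn : p ≤ 2 * n := by
    have : p ^ (t - 1) ≤ 2 * n := by exact_mod_cast hn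
    exact (Nat.le_self_pow (by omega) p).trans this
  exact ⟨n, by omega, le_log_exRand_div ht (by exact_mod_cast hprime.pos) (by omega) hn hE⟩

theorem le_exponentAt (t : ℕ) (ht : 4 ≤ t) :
    ((1 - 1 / ((t : ℝ) - 1) : ℝ) : EReal) ≤
      exponentAt (SimpleGraph.completeGraph (Fin t)) 4 := by
  refine le_of_forall_lt fun b hb => ?_
  obtain ⟨c, hbc, hc⟩ := exists_between hb
  refine hbc.trans_le (le_limsup_of_frequently_le ?_)
  have hlim : Tendsto (fun n : ℕ =>
      (((1 - 1 / ((t : ℝ) - 1)) - Real.log 8 / Real.log n : ℝ) : EReal)) atTop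
      (𝓝 ((1 - 1 / ((t : ℝ) - 1) : ℝ) : EReal)) := by
    refine (continuous_coe_real_ereal.tendsto _).comp ?_
    have := (tendsto_const_nhds (x := Real.log 8)).div_atTop
      (Real.tendsto_log_atTop.comp tendsto_natCast_atTop_atTop)
    simpa using this.const_sub (1 - 1 / ((t : ℝ) - 1))
  exact ((frequently_le_exRand t ht).and_eventually (hlim.eventually_const_lt hc)).mono
    fun n h => h.2.le.trans h.1

end PseudorandomTuran

theorem theorem1p1 (t : ℕ) (ht : 4 ≤ t) :
    ((1 - 1 / ((t : ℝ) - 1) : ℝ) : EReal) ≤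
      PseudorandomTuran.randExponent (SimpleGraph.completeGraph (Fin t)) :=
  (PseudorandomTuran.le_exponentAt t ht).trans
    ((PseudorandomTuran.exponentAt_mono _).ge_of_tendsto
      (PseudorandomTuran.tendsto_exponentAt _) 4)
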